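/- A budgeting scenario $E=(A,V,c,\ell)$ consists of a finite set $A$ of items, a finite set $V$ of voters, where each voter $v\in V$ has an approval set $A_v\subseteq A$, a cost function $c\colon A\to\mathbb{N}$, and a budget limit $\ell\in\mathbb{N}$. A budget $B\subseteq A$ is feasible if $c(B):=\sum_{b\in B}c(b)\le\ell$. Its total satisfaction is $u_E(B)=\sum_{v\in V}c(B_v)$, where $B_v=A_v\cap B$. The rule $\mathcal{R}^m_{c(B_v)}$ selects a feasible budget of maximum total satisfaction. Observation. There is an FPTAS for $\mathcal{R}^m_{c(B_v)}$. That is, there is an algorithm which, given a budgeting scenario $E$ (with $c$ and $\ell$ written in binary and the approval sets given as a $|V|\times|A|$ binary matrix) and a rational $\varepsilon>0$, outputs a feasible budget $B$ with $$u_E(B)\ \ge\ (1-\varepsilon)\cdot\max\{u_E(W) : W\subseteq A,\ c(W)\le\ell\},$$ and whose running time is bounded by a polynomial in the bit length of the input $(E,\varepsilon)$ and in $1/\varepsilon$. The running time is measured on a random access machine with logarithmic (bit-length) cost. -/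

import Mathlib

namespace Budgeting

/-! ### Budgeting scenarios and max rules -/

/-- A budgeting scenario `(A, V, c, ℓ)`: items `A = Fin m`, voters `V = Fin n`, the cost of every
item, the approval set of every voter, and the budget limit `ℓ`. -/
structure Scenario where
  /-- number of items -/
  m : ℕ
  /-- number of voters -/
  n : ℕ
  /-- cost function -/
  cost : Fin m → ℕ
  /-- approval set of each voter -/
  approval : Fin n → Finset (Fin m)
  /-- budget limit -/
  limit : ℕ

/-- A satisfaction function on the item set `A`: `f Av B` is the satisfaction of a voter with
approval set `Av` from the budget `B`. -/
abbrev SatisfactionFunction (A : Type) := Finset A → Finset A → ℕ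

/-- The satisfaction function `c(B_v)`, where `B_v = A_v ∩ B`: the total cost of the approved
budgeted items. -/
def costSatisfaction {A : Type} [DecidableEq A] (c : A → ℕ) : SatisfactionFunction A :=
  fun Av B => ∑ a ∈ Av ∩ B, c a

/-- `B` respects the budget limit. -/
def Scenario.Feasible (E : Scenario) (B : Finset (Fin E.m)) : Prop :=
  ∑ b ∈ B, E.cost b ≤ E.limit

/-- The sum of the satisfactions of all voters from `B`. -/
def Scenario.totalSatisfaction (E : Scenario) (f : SatisfactionFunction (Fin E.m))
    (B : Finset (Fin E.m)) : ℕ :=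
  ∑ v, f (E.approval v) B

/-- The winning budgets of the max rule for `f` (all of them, no ties are broken): the feasible
budgets of maximum total satisfaction. -/
def Scenario.maxRule (E : Scenario) (f : SatisfactionFunction (Fin E.m)) :
    Set (Finset (Fin E.m)) :=
  {W | E.Feasible W ∧ ∀ B, E.Feasible B → E.totalSatisfaction f B ≤ E.totalSatisfaction f W}

theorem Scenario.maxRule_nonempty (E : Scenario) (f : SatisfactionFunction (Fin E.m)) :
    (E.maxRule f).Nonempty := by
  obtain ⟨W, hW, h⟩ := Set.exists_max_image {B | E.Feasible B} (E.totalSatisfaction f)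
    (Set.toFinite _) ⟨∅, by simp [Scenario.Feasible]⟩
  exact ⟨W, hW, h⟩

/-! ### Random access programs with logarithmic cost

A program has scalar variables and arrays, each holding natural numbers of arbitrary size, and
structured control flow. Running time is charged by bit length: each operation costs at least the
bit lengths of its operands (and of the array indices it uses), and multiplication and division
cost the product of the bit lengths. Hence cost is polynomially related to the number of steps of a
multitape Turing machine. -/

/-- Arithmetic operations on natural numbers: sum, truncated difference, product, quotient
(rounded down, with value `0` if the divisor is `0`). -/
inductive Op where
  | add
  | sub
  | mul
  | div

/-- The result of an operation. -/
def Op.eval : Op → ℕ → ℕ → ℕ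
  | .add, x, y => x + y
  | .sub, x, y => x - y
  | .mul, x, y => x * y
  | .div, x, y => x / y

/-- The bit cost of an operation (`Nat.size x` is the binary length of `x`). -/
def Op.cost : Op → ℕ → ℕ → ℕ
  | .add, x, y => 1 + x.size + y.size
  | .sub, x, y => 1 + x.size + y.size
  | .mul, x, y => (1 + x.size) * (1 + y.size)
  | .div, x, y => (1 + x.size) * (1 + y.size)

/-- A memory state: the values of the variables, and the contents of the arrays. A program
mentions only finitely many variables and arrays. -/
structure State where
  /-- `var x` is the value of the variable number `x` -/
  var : ℕ → ℕ
  /-- `arr a i` is the content of cell `i` of the array number `a` -/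
  arr : ℕ → ℕ → ℕ

/-- `s.setVar x k` is `s` after the variable `x` has received the value `k`. -/
def State.setVar (s : State) (x k : ℕ) : State :=
  { s with var := Function.update s.var x k }

/-- `s.setArr a i k` is `s` after cell `i` of the array `a` has received the value `k`. -/
def State.setArr (s : State) (a i k : ℕ) : State :=
  { s with arr := Function.update s.arr a (Function.update (s.arr a) i k) }

/-- Expressions: constants, variables, array cells `a[e]`, and arithmetic. -/
inductive Expr where
  | const (k : ℕ)
  | var (x : ℕ)
  | cell (a : ℕ) (e : Expr)
  | op (o : Op) (e₁ e₂ : Expr)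

/-- The value of an expression. -/
def Expr.eval (s : State) : Expr → ℕ
  | .const k => k
  | .var x => s.var x
  | .cell a e => s.arr a (e.eval s)
  | .op o e₁ e₂ => o.eval (e₁.eval s) (e₂.eval s)

/-- The cost of evaluating an expression. -/
def Expr.cost (s : State) : Expr → ℕ
  | .const k => 1 + k.size
  | .var x => 1 + (s.var x).size
  | .cell a e => e.cost s + 1 + (e.eval s).size + (s.arr a (e.eval s)).size
  | .op o e₁ e₂ => e₁.cost s + e₂.cost s + o.cost (e₁.eval s) (e₂.eval s)

/-- Programs. `assign x e` is `x := e`; `store a e₁ e₂` is `a[e₁] := e₂`; `branch` and `loop`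
test whether an expression is nonzero. -/
inductive Program where
  | skip
  | assign (x : ℕ) (e : Expr)
  | store (a : ℕ) (e₁ e₂ : Expr)
  | seq (P Q : Program)
  | branch (e : Expr) (P Q : Program)
  | loop (e : Expr) (P : Program)

/-- `Exec P s t s₁`: the program `P`, started in `s`, halts in `s₁` after running time `t`. -/
inductive Exec : Program → State → ℕ → State → Prop where
  | skip (s : State) : Exec .skip s 1 s
  | assign (x : ℕ) (e : Expr) (s : State) :
      Exec (.assign x e) s (e.cost s + 1) (s.setVar x (e.eval s))
  | store (a : ℕ) (e₁ e₂ : Expr) (s : State) :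
      Exec (.store a e₁ e₂) s (e₁.cost s + e₂.cost s + 1) (s.setArr a (e₁.eval s) (e₂.eval s))
  | seq {P Q : Program} {s s₁ s₂ : State} {t₁ t₂ : ℕ} :
      Exec P s t₁ s₁ → Exec Q s₁ t₂ s₂ → Exec (.seq P Q) s (t₁ + t₂) s₂
  | branch_true {e : Expr} {P Q : Program} {s s₁ : State} {t : ℕ} :
      e.eval s ≠ 0 → Exec P s t s₁ → Exec (.branch e P Q) s (e.cost s + 1 + t) s₁
  | branch_false {e : Expr} {P Q : Program} {s s₁ : State} {t : ℕ} :
      e.eval s = 0 → Exec Q s t s₁ → Exec (.branch e P Q) s (e.cost s + 1 + t) s₁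
  | loop_true {e : Expr} {P : Program} {s s₁ s₂ : State} {t₁ t₂ : ℕ} :
      e.eval s ≠ 0 → Exec P s t₁ s₁ → Exec (.loop e P) s₁ t₂ s₂ →
      Exec (.loop e P) s (e.cost s + 1 + t₁ + t₂) s₂
  | loop_false {e : Expr} {P : Program} {s : State} :
      e.eval s = 0 → Exec (.loop e P) s (e.cost s + 1) s

/-- Running time and final state are determined by the program and the initial state. -/
theorem Exec.deterministic {P : Program} {s s₁ s₂ : State} {t₁ t₂ : ℕ}
    (h₁ : Exec P s t₁ s₁) (h₂ : Exec P s t₂ s₂) : t₁ = t₂ ∧ s₁ = s₂ := by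
  induction h₁ generalizing t₂ s₂ with
  | skip | assign | store => cases h₂; exact ⟨rfl, rfl⟩
  | seq _ _ ih₁ ih₂ =>
    cases h₂ with
    | seq a b =>
      obtain ⟨rfl, rfl⟩ := ih₁ a
      obtain ⟨rfl, rfl⟩ := ih₂ b
      exact ⟨rfl, rfl⟩
  | branch_true he _ ih | branch_false he _ ih =>
    cases h₂ with
    | branch_true he₂ a =>
      first
        | exact absurd he he₂
        | (obtain ⟨rfl, rfl⟩ := ih a
           exact ⟨rfl, rfl⟩)
    | branch_false he₂ a =>
      first
        | exact absurd he₂ he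
        | (obtain ⟨rfl, rfl⟩ := ih a
           exact ⟨rfl, rfl⟩)
  | loop_true he _ _ ih₁ ih₂ =>
    cases h₂ with
    | loop_true _ a b =>
      obtain ⟨rfl, rfl⟩ := ih₁ a
      obtain ⟨rfl, rfl⟩ := ih₂ b
      exact ⟨rfl, rfl⟩
    | loop_false he₂ => exact absurd he₂ he
  | loop_false he =>
    cases h₂ with
    | loop_true he₂ => exact absurd he he₂
    | loop_false => exact ⟨rfl, rfl⟩

/-! ### Input, output, and approximation schemes -/

/-- The initial state for a scenario `E` and a positive rational accuracy `ε`. The variables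
`0, …, 4` hold `m`, `n`, `ℓ`, and the numerator and denominator of `ε`. Array `0` holds the costs,
and array `1` holds the `n × m` approval matrix row by row: cell `i * m + j` is `1` if voter `i`
approves item `j`. Everything else is `0`. -/
def initialState (E : Scenario) (ε : ℚ) : State where
  var
    | 0 => E.m
    | 1 => E.n
    | 2 => E.limit
    | 3 => ε.num.toNat
    | 4 => ε.den
    | _ => 0
  arr
    | 0 => fun j => if h : j < E.m then E.cost ⟨j, h⟩ else 0
    | 1 => fun k =>
        if h : k / E.m < E.n ∧ k % E.m < E.m then
          if (⟨k % E.m, h.2⟩ : Fin E.m) ∈ E.approval ⟨k / E.m, h.1⟩ then 1 else 0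
        else 0
    | _ => fun _ => 0

/-- The number of bits of a scenario: numbers are written in binary, and the approval sets as an
`n × m` binary matrix. -/
def Scenario.size (E : Scenario) : ℕ :=
  E.m.size + E.n.size + E.limit.size + ∑ j, ((E.cost j).size + 1) + E.n * E.m

/-- The number of bits of a positive rational, given by numerator and denominator. -/
def ratSize (ε : ℚ) : ℕ := ε.num.toNat.size + ε.den.size

/-- In the state `s`, array `2` holds the indicator vector of the budget `B`. -/
def Outputs (E : Scenario) (s : State) (B : Finset (Fin E.m)) : Prop :=
  ∀ j : Fin E.m, s.arr 2 j = if j ∈ B then 1 else 0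

/-- `P` is a fully polynomial-time approximation scheme for the max rule of the satisfaction
function `f` (which may depend on the scenario, e.g. on its costs): on every scenario `E` and every
rational `ε > 0`, it computes a feasible budget whose total satisfaction is at least `1 - ε` times
that of a winning budget, in time polynomial in the input length and in `1 / ε`. -/
def IsFPTAS (f : (E : Scenario) → SatisfactionFunction (Fin E.m)) (P : Program) : Prop :=
  ∃ p : Polynomial ℕ, ∀ (E : Scenario) (ε : ℚ), 0 < ε →
    ∃ (t : ℕ) (s : State) (B : Finset (Fin E.m)),
      Exec P (initialState E ε) t s ∧
      t ≤ p.eval (E.size + ratSize ε + ⌈1 / ε⌉₊) ∧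
      Outputs E s B ∧
      E.Feasible B ∧
      ∀ W ∈ E.maxRule (f E),
        (1 - ε) * (E.totalSatisfaction (f E) W : ℚ) ≤ (E.totalSatisfaction (f E) B : ℚ)

end Budgeting

namespace Budgeting

/-! ### Timed Hoare logic -/

/-! Total satisfaction is additive: an item `a` contributes its profit `p(a)`, its cost times the
number of its approvers. So the task is a knapsack problem, solved by profit scaling.

Let `M` be the largest profit of an item that is affordable on its own, and `q(a) = ⌊p(a) m / (ε
M)⌋`. Affordable items have `q(a) ≤ m / ε`, so every feasible set has scaled value below
`rowLength`, which is polynomial in `m` and `1 / ε`. Dynamic programming over scaled values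
(`minCost`, `pick_spec`, `minCost_le_sum`) then finds a feasible set of largest scaled value.
Rounding loses at most `ε M / m` of profit per item (`sum_le_of_scaled`), hence at most `ε M` in
all, and `M` is at most the optimum since the singleton attaining it is feasible (`nearly_optimal`).

For the running time, `Runs` counts elementary steps in a unit that pays for any single instruction.
If the input measure is `X`, all stored numbers have at most `6 * X` bits, so an instruction costs
`O(X ^ 2)`. The number of steps is polynomial in `X` by `rowLength_le` and `steps_le`. -/

instance (k : ℕ) : OfNat Expr k := ⟨.const k⟩
instance : Add Expr := ⟨.op .add⟩
instance : Sub Expr := ⟨.op .sub⟩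
instance : Mul Expr := ⟨.op .mul⟩
instance : Div Expr := ⟨.op .div⟩

section eval
variable (s : State) (e₁ e₂ : Expr)

@[simp] theorem Expr.eval_zero : Expr.eval s 0 = 0 := rfl
@[simp] theorem Expr.eval_one : Expr.eval s 1 = 1 := rfl
@[simp] theorem Expr.eval_var (x : ℕ) : Expr.eval s (.var x) = s.var x := rfl
@[simp] theorem Expr.eval_cell (a : ℕ) : Expr.eval s (.cell a e₁) = s.arr a (e₁.eval s) := rfl
@[simp] theorem Expr.eval_add : (e₁ + e₂).eval s = e₁.eval s + e₂.eval s := rfl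
@[simp] theorem Expr.eval_sub : (e₁ - e₂).eval s = e₁.eval s - e₂.eval s := rfl
@[simp] theorem Expr.eval_mul : (e₁ * e₂).eval s = e₁.eval s * e₂.eval s := rfl
@[simp] theorem Expr.eval_div : (e₁ / e₂).eval s = e₁.eval s / e₂.eval s := rfl

end eval

section update
variable (s : State)

@[simp] theorem State.setVar_var (x k y : ℕ) :
    (s.setVar x k).var y = if y = x then k else s.var y := by
  simp [State.setVar, Function.update_apply]

@[simp] theorem State.setVar_arr (x k : ℕ) : (s.setVar x k).arr = s.arr := rfl

@[simp] theorem State.setArr_var (a i k : ℕ) : (s.setArr a i k).var = s.var := rfl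

@[simp] theorem State.setArr_arr (a i k a' : ℕ) :
    (s.setArr a i k).arr a' = if a' = a then Function.update (s.arr a) i k else s.arr a' := by
  simp only [State.setArr, Function.update_apply]

end update

/-- All values stored in the state have at most `b` bits, where `b` is positive. -/
structure Bounded (b : ℕ) (s : State) : Prop where
  pos : 1 ≤ b
  var (x : ℕ) : s.var x < 2 ^ b
  arr (a i : ℕ) : s.arr a i < 2 ^ b

theorem Bounded.setVar {b : ℕ} {s : State} (h : Bounded b s) (x : ℕ) {k : ℕ} (hk : k < 2 ^ b) :
    Bounded b (s.setVar x k) where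
  pos := h.pos
  var y := by
    rw [State.setVar_var]
    split
    · exact hk
    · exact h.var y
  arr := h.arr

theorem Bounded.setArr {b : ℕ} {s : State} (h : Bounded b s) (a i : ℕ) {k : ℕ} (hk : k < 2 ^ b) :
    Bounded b (s.setArr a i k) where
  pos := h.pos
  var := h.var
  arr a' i' := by
    rw [State.setArr_arr]
    split
    · rw [Function.update_apply]
      split
      · exact hk
      · exact h.arr _ _
    · exact h.arr _ _

/-- A constant that governs the bit length of the value of an expression and its cost. -/
def Expr.weight : Expr → ℕ
  | .const k => k + 1
  | .var _ => 2
  | .cell _ e => 2 * e.weight + 2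
  | .op _ e₁ e₂ => e₁.weight + e₂.weight + (1 + e₁.weight) * (1 + e₂.weight)

/-! ### Bit lengths of values and costs of expressions -/

theorem size_le_self (k : ℕ) : k.size ≤ k := Nat.size_le.2 k.lt_two_pow_self

theorem size_mono {x y : ℕ} (h : x ≤ y) : x.size ≤ y.size := Nat.size_le_size h

theorem size_add_le (x y : ℕ) : (x + y).size ≤ x.size + y.size + 1 := by
  rw [Nat.size_le]
  have hx := Nat.lt_size_self x
  have hy := Nat.lt_size_self y
  have h1 : 2 ^ x.size ≤ 2 ^ (x.size + y.size) := Nat.pow_le_pow_right (by norm_num) (by omega)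
  have h2 : 2 ^ y.size ≤ 2 ^ (x.size + y.size) := Nat.pow_le_pow_right (by norm_num) (by omega)
  rw [pow_succ]
  omega

theorem size_mul_le (x y : ℕ) : (x * y).size ≤ x.size + y.size := by
  rw [Nat.size_le, pow_add]
  exact Nat.mul_lt_mul'' (Nat.lt_size_self x) (Nat.lt_size_self y)

theorem Op.size_eval_le (o : Op) (x y : ℕ) : (o.eval x y).size ≤ x.size + y.size + 1 := by
  cases o with
  | add => exact size_add_le x y
  | sub => exact (size_mono (Nat.sub_le x y)).trans (by omega)
  | mul => exact (size_mul_le x y).trans (by omega)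
  | div => exact (size_mono (Nat.div_le_self x y)).trans (by omega)

theorem Op.cost_le (o : Op) (x y : ℕ) : o.cost x y ≤ (1 + x.size) * (1 + y.size) := by
  cases o <;> simp only [Op.cost] <;> nlinarith [Nat.zero_le (x.size * y.size)]

/-- Only stored values are required to fit into `b` bits. An operation at most adds the lengths of
its operands plus one, so intermediate values have length linear in `b`, with a factor depending
only on the expression. -/
theorem Expr.size_eval_le {b : ℕ} {s : State} (h : Bounded b s) (e : Expr) :
    (e.eval s).size ≤ e.weight * b := by
  have hb := h.pos
  induction e with
  | const k => exact (size_le_self k).trans (by simp only [weight]; nlinarith)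
  | var x =>
    exact (Nat.size_le.2 (h.var x)).trans (by simp only [weight]; omega)
  | cell a e _ => exact (Nat.size_le.2 (h.arr a _)).trans (by simp only [weight]; nlinarith)
  | op o e₁ e₂ ih₁ ih₂ =>
    refine (o.size_eval_le _ _).trans ?_
    simp only [weight]
    nlinarith [Nat.zero_le (e₁.weight * b), Nat.zero_le (e₂.weight * b),
      Nat.zero_le (e₁.weight * e₂.weight * b)]

theorem Expr.cost_le {b : ℕ} {s : State} (h : Bounded b s) (e : Expr) :
    e.cost s ≤ e.weight * b ^ 2 := by
  have hb := h.pos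
  have hb2 : b ≤ b ^ 2 := by nlinarith
  induction e with
  | const k =>
    have := size_le_self k
    simp only [cost, weight]
    nlinarith
  | var x =>
    have := Nat.size_le.2 (h.var x)
    simp only [cost, weight]
    omega
  | cell a e ih =>
    have h1 := Nat.size_le.2 (h.arr a (e.eval s))
    have h2 := e.size_eval_le h
    have h3 : e.weight * b ≤ e.weight * b ^ 2 := Nat.mul_le_mul_left _ hb2
    simp only [cost, weight]
    nlinarith
  | op o e₁ e₂ ih₁ ih₂ =>
    have h1 := e₁.size_eval_le h
    have h2 := e₂.size_eval_le h
    have h3 : (1 + (e₁.eval s).size) * (1 + (e₂.eval s).size) ≤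
        ((1 + e₁.weight) * b) * ((1 + e₂.weight) * b) :=
      Nat.mul_le_mul (by nlinarith) (by nlinarith)
    have h4 := o.cost_le (e₁.eval s) (e₂.eval s)
    simp only [cost, weight]
    nlinarith

/-- The strict inequality between weights leaves room for the unit that an instruction pays on top
of its expression. -/
theorem Expr.cost_lt {b w : ℕ} {s : State} (h : Bounded b s) {e : Expr} (hw : e.weight < w) :
    e.cost s + 1 ≤ w * b ^ 2 := by
  have h1 := e.cost_le h
  have h2 : (e.weight + 1) * b ^ 2 ≤ w * b ^ 2 := Nat.mul_le_mul_right _ hw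
  have h3 : 1 ≤ b ^ 2 := Nat.one_le_pow _ _ h.pos
  nlinarith

/-- Started in `s`, the program halts in time at most `k * C`, in a state that satisfies `Q`. -/
def Runs (C : ℕ) (P : Program) (s : State) (k : ℕ) (Q : State → Prop) : Prop :=
  ∃ t s', Exec P s t s' ∧ t ≤ k * C ∧ Q s'

/-! ### Proof rules for timed runs -/

section rules
variable {b w C k k₁ k₂ : ℕ} {s : State} {e e₁ e₂ : Expr} {P P₁ P₂ : Program}
  {Q R : State → Prop}

theorem Runs.mono (h : Runs C P s k₁ Q) (hk : k₁ ≤ k) (hQ : ∀ s', Q s' → R s') :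
    Runs C P s k R := by
  obtain ⟨t, s', hP, ht, hs⟩ := h
  exact ⟨t, s', hP, ht.trans (Nat.mul_le_mul_right _ hk), hQ _ hs⟩

theorem Runs.assign (x : ℕ) (hb : Bounded b s) (hw : e.weight < w)
    (hQ : Q (s.setVar x (e.eval s))) : Runs (w * b ^ 2) (.assign x e) s 1 Q :=
  ⟨_, _, .assign x e s, by rw [one_mul]; exact Expr.cost_lt hb hw, hQ⟩

theorem Runs.store (a : ℕ) (hb : Bounded b s) (hw : e₁.weight + e₂.weight < w)
    (hQ : Q (s.setArr a (e₁.eval s) (e₂.eval s))) :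
    Runs (w * b ^ 2) (.store a e₁ e₂) s 1 Q := by
  refine ⟨_, _, .store a e₁ e₂ s, ?_, hQ⟩
  have h1 := e₁.cost_le hb
  have h2 : e₂.cost s + 1 ≤ (w - e₁.weight) * b ^ 2 := Expr.cost_lt hb (by omega)
  rw [Nat.sub_mul] at h2
  omega

theorem Runs.seq (h : Runs C P₁ s k₁ Q) (hQ : ∀ s', Q s' → Runs C P₂ s' k₂ R) :
    Runs C (.seq P₁ P₂) s (k₁ + k₂) R := by
  obtain ⟨t₁, s₁, h₁, ht₁, hs₁⟩ := h
  obtain ⟨t₂, s₂, h₂, ht₂, hs₂⟩ := hQ _ hs₁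
  exact ⟨_, _, h₁.seq h₂, by rw [add_mul]; exact Nat.add_le_add ht₁ ht₂, hs₂⟩

theorem Runs.branch (hb : Bounded b s) (hw : e.weight < w)
    (h₁ : e.eval s ≠ 0 → Runs (w * b ^ 2) P₁ s k Q)
    (h₂ : e.eval s = 0 → Runs (w * b ^ 2) P₂ s k Q) :
    Runs (w * b ^ 2) (.branch e P₁ P₂) s (1 + k) Q := by
  have hc := Expr.cost_lt hb hw
  by_cases he : e.eval s = 0
  · obtain ⟨t, s', h, ht, hs⟩ := h₂ he
    exact ⟨_, _, .branch_false he h, by rw [add_mul, one_mul]; exact Nat.add_le_add hc ht, hs⟩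
  · obtain ⟨t, s', h, ht, hs⟩ := h₁ he
    exact ⟨_, _, .branch_true he h, by rw [add_mul, one_mul]; exact Nat.add_le_add hc ht, hs⟩

theorem Runs.skip (hb : Bounded b s) (hw : 1 ≤ w) (hQ : Q s) :
    Runs (w * b ^ 2) .skip s 1 Q :=
  ⟨_, _, .skip s, by rw [one_mul]; exact Nat.mul_pos hw (Nat.pow_pos hb.pos), hQ⟩

/-- The loop rule: `I r` holds before every test, where `r` bounds the number of iterations that
remain. -/
theorem Runs.loop (I : ℕ → State → Prop) (hw : e.weight < w)
    (hb : ∀ r s, I r s → Bounded b s)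
    (hI : ∀ r s, I r s → e.eval s ≠ 0 → ∃ r', r = r' + 1 ∧ Runs (w * b ^ 2) P s k (I r'))
    {r : ℕ} (hs : I r s) :
    Runs (w * b ^ 2) (.loop e P) s (r * (k + 1) + 1) (fun s' => ∃ r', I r' s' ∧ e.eval s' = 0) := by
  induction r generalizing s with
  | zero =>
    have hc := Expr.cost_lt (hb _ _ hs) hw
    by_cases he : e.eval s = 0
    · exact ⟨_, _, .loop_false he, by omega, _, hs, he⟩
    · obtain ⟨r', hr, _⟩ := hI _ _ hs he
      omega
  | succ r ih =>
    have hc := Expr.cost_lt (hb _ _ hs) hw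
    by_cases he : e.eval s = 0
    · exact ⟨_, _, .loop_false he, by nlinarith [Nat.zero_le ((r + 1) * (k + 1))], _, hs, he⟩
    · obtain ⟨r', hr, t₁, s₁, h₁, ht₁, hs₁⟩ := hI _ _ hs he
      obtain rfl : r = r' := by omega
      obtain ⟨t₂, s₂, h₂, ht₂, hs₂⟩ := ih hs₁
      refine ⟨_, _, .loop_true he h₁ h₂, ?_, hs₂⟩
      calc e.cost s + 1 + t₁ + t₂
          ≤ w * b ^ 2 + k * (w * b ^ 2) + (r * (k + 1) + 1) * (w * b ^ 2) := by omega
        _ = _ := by ring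

/-- `for x = 0, …, N - 1 do P`, where `e` evaluates to `N`. -/
def forLoop (x : ℕ) (e : Expr) (P : Program) : Program :=
  .seq (.assign x 0) (.loop (e - .var x) (.seq P (.assign x (.var x + 1))))

theorem Runs.forLoop (J : ℕ → State → Prop) (x N : ℕ) (hw : (e - .var x : Expr).weight < w)
    (hw' : 14 ≤ w) (hs : Bounded b s) (h0 : J 0 (s.setVar x 0))
    (hJ : ∀ i s, J i s → Bounded b s ∧ s.var x = i ∧ e.eval s = N)
    (hP : ∀ i s, i < N → J i s → Runs (w * b ^ 2) P s k
      (fun s' => Bounded b s' ∧ s'.var x = i ∧ J (i + 1) (s'.setVar x (i + 1)))) :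
    Runs (w * b ^ 2) (forLoop x e P) s (N * (k + 2) + 2) (J N) := by
  have h1 : Runs (w * b ^ 2) (.assign x 0) s 1 (J 0) :=
    Runs.assign x hs (lt_of_lt_of_le (by decide) hw') h0
  refine (h1.seq (k₂ := N * (k + 1 + 1) + 1) (R := J N) fun s' hs' => ?_).mono
    (by linarith) fun _ h => h
  -- The loop rule counts the remaining iterations `r` downwards, while `J` is indexed by the
  -- counter `N - r`.
  refine (Runs.loop (fun r s => r ≤ N ∧ J (N - r) s) hw (fun r s h => (hJ _ _ h.2).1) ?_
    (r := N) (by simpa using hs')).mono le_rfl ?_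
  · rintro r s ⟨hr, h⟩ he
    obtain ⟨hb, hx, hN⟩ := hJ _ _ h
    simp only [Expr.eval_sub, Expr.eval_var, hx, hN] at he
    obtain ⟨r', rfl⟩ : ∃ r', r = r' + 1 := ⟨r - 1, by omega⟩
    refine ⟨r', rfl, (hP _ _ (by omega) h).seq fun s' hs' => ?_⟩
    obtain ⟨hb', hx', hJ'⟩ := hs'
    refine Runs.assign x hb' (lt_of_lt_of_le (b := 14) ?_ hw') ⟨by omega, ?_⟩
    -- The weight of `.var x + 1` is `2 + 2 + 3 * 3`.
    · change 13 < 14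
      norm_num
    · simp only [Expr.eval_add, Expr.eval_var, Expr.eval_one, hx']
      rwa [show N - r' = N - (r' + 1) + 1 by omega]
  · rintro s ⟨r, ⟨hr, h⟩, he⟩
    obtain ⟨hb, hx, hN⟩ := hJ _ _ h
    simp only [Expr.eval_sub, Expr.eval_var, hx, hN] at he
    rwa [show N = N - r by omega]

end rules

/-! ### The dynamic program -/

section dynamicProgram
variable (c q : ℕ → ℕ) (l : ℕ)

/-- The least cost of a set of items below `j` of value at least `v`; costs over the limit `l` may
be misrepresented by other numbers over `l`. -/
def minCost : ℕ → ℕ → ℕ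
  | 0, v => v * (l + 1)
  | j + 1, v => min (minCost j v) (c j + minCost j (v - q j))

/-- A set of items that realizes `minCost`. -/
def pick : ℕ → ℕ → Finset ℕ
  | 0, _ => ∅
  | j + 1, v =>
    if minCost c q l (j + 1) v < minCost c q l j v then insert j (pick j (v - q j)) else pick j v

/-- Taking minima never raises the base row. This bounds the bit length of the table entries, and
forces the value `0` in column `0`. -/
theorem minCost_le (j v : ℕ) : minCost c q l j v ≤ v * (l + 1) := by
  induction j with
  | zero => exact le_rfl
  | succ j ih => exact (min_le_left _ _).trans ih

theorem minCost_zero (j : ℕ) : minCost c q l j 0 = 0 := by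
  simpa using minCost_le c q l j 0

theorem pick_subset (j v : ℕ) : pick c q l j v ⊆ Finset.range j := by
  induction j generalizing v with
  | zero => simp [pick]
  | succ j ih =>
    have hj : Finset.range j ⊆ Finset.range (j + 1) := Finset.range_subset_range.2 (by omega)
    rw [pick]
    split
    · exact Finset.insert_subset (by simp) ((ih _).trans hj)
    · exact (ih _).trans hj

/-- In the base row, `v * (l + 1)` stands for infinity when `v > 0`. An entry within the limit is
therefore genuine: its recursion must end at `v = 0`, which the empty set attains. -/
theorem pick_spec (j v : ℕ) (h : minCost c q l j v ≤ l) :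
    ∑ i ∈ pick c q l j v, c i ≤ l ∧ ∑ i ∈ pick c q l j v, c i = minCost c q l j v ∧
      v ≤ ∑ i ∈ pick c q l j v, q i := by
  induction j generalizing v with
  | zero =>
    obtain rfl : v = 0 := by
      by_contra hv
      have : 1 * (l + 1) ≤ v * (l + 1) := Nat.mul_le_mul_right _ (Nat.pos_of_ne_zero hv)
      rw [minCost] at h
      omega
    simp [pick, minCost]
  | succ j ih =>
    by_cases hlt : minCost c q l (j + 1) v < minCost c q l j v
    · have he : minCost c q l (j + 1) v = c j + minCost c q l j (v - q j) := by
        rw [minCost] at hlt ⊢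
        omega
      obtain ⟨-, h2, h3⟩ := ih (v - q j) (by omega)
      have hj : j ∉ pick c q l j (v - q j) := fun hj => by
        simpa using pick_subset c q l j _ hj
      rw [pick, if_pos hlt, Finset.sum_insert hj, Finset.sum_insert hj]
      omega
    · have he : minCost c q l (j + 1) v = minCost c q l j v := by
        rw [minCost] at hlt ⊢
        omega
      rw [pick, if_neg hlt, he]
      exact ih v (he ▸ h)

/-- If `j` lies in `S`, the rest of `S` has to attain only `v - q j`; truncated subtraction covers
the case that `j` alone suffices. -/
theorem minCost_le_sum (j v : ℕ) (S : Finset ℕ) (hS : S ⊆ Finset.range j)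
    (hv : v ≤ ∑ i ∈ S, q i) : minCost c q l j v ≤ ∑ i ∈ S, c i := by
  induction j generalizing v S with
  | zero =>
    obtain rfl : S = ∅ := by simpa using hS
    obtain rfl : v = 0 := by simpa using hv
    simp [minCost]
  | succ j ih =>
    rw [Finset.range_add_one] at hS
    rw [minCost]
    by_cases hj : j ∈ S
    · rw [← Finset.insert_erase hj, Finset.sum_insert (by simp)] at hv ⊢
      refine (min_le_right _ _).trans (Nat.add_le_add_left (ih _ _ ?_ (by omega)) _)
      rwa [← Finset.subset_insert_iff]
    · exact (min_le_left _ _).trans (ih _ _ ((Finset.subset_insert_iff_of_notMem hj).1 hS) hv)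

end dynamicProgram

/-- The rounding argument: a set that is optimal for the values `p i * D / N`, rounded down, is
nearly optimal for the values `p`. -/
theorem sum_le_of_scaled {p q : ℕ → ℕ} {D N : ℕ} (hN : 0 < N) (hq : ∀ i, q i = p i * D / N)
    {S W : Finset ℕ} (h : ∑ i ∈ W, q i ≤ ∑ i ∈ S, q i) :
    (∑ i ∈ W, p i) * D ≤ (∑ i ∈ S, p i) * D + W.card * N := by
  -- Rounding down loses less than one unit `N / D` per item of `W`; for `S` it only helps.
  have h1 : (∑ i ∈ W, p i) * D ≤ ∑ i ∈ W, (q i + 1) * N := by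
    rw [Finset.sum_mul]
    refine Finset.sum_le_sum fun i _ => ?_
    rw [hq, mul_comm _ N]
    exact (Nat.lt_mul_div_succ _ hN).le
  have h2 : (∑ i ∈ S, q i) * N ≤ (∑ i ∈ S, p i) * D := by
    rw [Finset.sum_mul, Finset.sum_mul]
    refine Finset.sum_le_sum fun i _ => ?_
    rw [hq]
    exact Nat.div_mul_le_self _ _
  rw [← Finset.sum_mul, Finset.sum_add_distrib, Finset.sum_const, smul_eq_mul, mul_one] at h1
  have h3 := Nat.mul_le_mul_right N h
  linarith

/-! ### The program -/

/-- The scaled profit of the item in variable `5`. -/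
def scaledExpr : Expr :=
  .cell 3 (.var 5) * (.var 0 * .var 4) / (.var 3 * .var 8)

/-- Array `3` receives the profits, variable `8` the largest profit of an affordable item. -/
def profitProgram : Program :=
  .seq (.assign 8 0) <| forLoop 5 (.var 0) <|
    .seq (.assign 7 0) <|
    .seq (forLoop 6 (.var 1) (.assign 7 (.var 7 + .cell 1 (.var 6 * .var 0 + .var 5)))) <|
    .seq (.store 3 (.var 5) (.var 7 * .cell 0 (.var 5))) <|
    .branch ((.var 2 + 1 - .cell 0 (.var 5)) * (.cell 3 (.var 5) - .var 8))
      (.assign 8 (.cell 3 (.var 5))) .skip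

/-- Array `4` receives the table of the dynamic program, row by row; variable `9` receives the
length of the rows. -/
def tableProgram : Program :=
  .seq (.assign 9 (.var 0 * (.var 0 * .var 4 / .var 3 + 1) + 1)) <|
  .seq (forLoop 10 (.var 9) (.store 4 (.var 10) (.var 10 * (.var 2 + 1)))) <|
  forLoop 10 (.var 0 * .var 9) <|
    .seq (.assign 5 (.var 10 / .var 9)) <|
    .seq (.assign 6 (.var 5 * .var 9 + ((.var 10 - .var 5 * .var 9) - scaledExpr))) <|
    .store 4 (.var 10 + .var 9)
      (.cell 4 (.var 10) - (.cell 4 (.var 10) - (.cell 0 (.var 5) + .cell 4 (.var 6))))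

/-- Variable `6` receives the largest value that is attained within the limit. -/
def searchProgram : Program :=
  .seq (.assign 6 (.var 9 - 1)) <|
  .loop (.cell 4 (.var 0 * .var 9 + .var 6) - .var 2) (.assign 6 (.var 6 - 1))

/-- Array `2` receives the budget, which is read off the table backwards. -/
def outputProgram : Program :=
  .seq (.assign 5 (.var 0)) <|
  .loop (.var 5) <|
    .seq (.assign 5 (.var 5 - 1)) <|
    .branch (.cell 4 (.var 5 * .var 9 + .var 6) - .cell 4 ((.var 5 + 1) * .var 9 + .var 6))
      (.seq (.store 2 (.var 5) 1) (.assign 6 (.var 6 - scaledExpr)))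
      (.store 2 (.var 5) 0)

/-- The approximation scheme. -/
def budgetProgram : Program :=
  .seq profitProgram <| .seq tableProgram <| .seq searchProgram outputProgram

/-! ### What the program computes -/

section spec
variable (s₀ : State)

/-- The contribution of item `j` to the total satisfaction. -/
def profit (j : ℕ) : ℕ :=
  (∑ i ∈ Finset.range (s₀.var 1), s₀.arr 1 (i * s₀.var 0 + j)) * s₀.arr 0 j

/-- The largest profit of an affordable item below `j`. -/
def maxProfit : ℕ → ℕ
  | 0 => 0
  | j + 1 =>
    if s₀.arr 0 j ≤ s₀.var 2 ∧ maxProfit j < profit s₀ j then profit s₀ j else maxProfit j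

/-- The scaled profit of item `j`. -/
def scaled (j : ℕ) : ℕ :=
  profit s₀ j * (s₀.var 0 * s₀.var 4) / (s₀.var 3 * maxProfit s₀ (s₀.var 0))

/-- The length of the rows of the table. -/
def rowLength : ℕ := s₀.var 0 * (s₀.var 0 * s₀.var 4 / s₀.var 3 + 1) + 1

/-- The entry of the table in row `j`, column `v`. -/
def entry (j v : ℕ) : ℕ := minCost (s₀.arr 0) (scaled s₀) (s₀.var 2) j v

/-- The items below `j` that the program picks for the value `v`. -/
def picked (j v : ℕ) : Finset ℕ := pick (s₀.arr 0) (scaled s₀) (s₀.var 2) j v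

/-- All input numbers have at most `X` bits. -/
structure Small (X : ℕ) : Prop where
  pos : 1 ≤ X
  bounded : Bounded X s₀
  arr_one (k : ℕ) : s₀.arr 1 k ≤ 1

variable {s₀} {X : ℕ}

theorem profit_le_maxProfit {i j : ℕ} (hij : i < j) (hi : s₀.arr 0 i ≤ s₀.var 2) :
    profit s₀ i ≤ maxProfit s₀ j := by
  induction j with
  | zero => omega
  | succ j ih =>
    rw [maxProfit]
    rcases Nat.lt_succ_iff_lt_or_eq.1 hij with h | rfl
    · have := ih h
      split <;> omega
    · split <;> omega

theorem exists_profit_eq_maxProfit (s₀ : State) (j : ℕ) :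
    maxProfit s₀ j = 0 ∨ ∃ i < j, s₀.arr 0 i ≤ s₀.var 2 ∧ profit s₀ i = maxProfit s₀ j := by
  induction j with
  | zero => exact .inl rfl
  | succ j ih =>
    rw [maxProfit]
    split
    · next h => exact .inr ⟨j, by omega, h.1, rfl⟩
    · exact ih.imp_right fun ⟨i, hi, h⟩ => ⟨i, by omega, h⟩

theorem Small.sum_le (h : Small s₀ X) (i j : ℕ) :
    ∑ i ∈ Finset.range i, s₀.arr 1 (i * s₀.var 0 + j) ≤ i := by
  simpa using Finset.sum_le_card_nsmul (Finset.range i) _ 1 fun k _ => h.arr_one _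

/-- Profits need `2 * X` bits, table entries and indices `5 * X`; `6 * X` serves as a common bound
with room to spare. -/
theorem Small.profit_lt (h : Small s₀ X) (j : ℕ) : profit s₀ j < 2 ^ (6 * X) :=
  calc profit s₀ j < 2 ^ X * 2 ^ X :=
        Nat.mul_lt_mul'' ((h.sum_le _ j).trans_lt (h.bounded.var 1)) (h.bounded.arr 0 j)
    _ = 2 ^ (2 * X) := by ring
    _ ≤ _ := Nat.pow_le_pow_right (by norm_num) (by omega)

/-- Only the bit length matters here, so the division is simply dropped. The polynomial bound on the
number of columns needs `1 / ε` and is proved separately. -/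
theorem Small.rowLength_le (h : Small s₀ X) : rowLength s₀ ≤ 2 ^ (4 * X) := by
  have h0 : s₀.var 0 + 1 ≤ 2 ^ X := h.bounded.var 0
  have h4 : s₀.var 4 + 1 ≤ 2 ^ X := h.bounded.var 4
  have h1 : s₀.var 0 * s₀.var 4 / s₀.var 3 ≤ s₀.var 0 * s₀.var 4 := Nat.div_le_self _ _
  rw [rowLength]
  calc s₀.var 0 * (s₀.var 0 * s₀.var 4 / s₀.var 3 + 1) + 1
      ≤ (s₀.var 0 + 1) * ((s₀.var 0 + 1) * (s₀.var 4 + 1)) := by nlinarith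
    _ ≤ 2 ^ X * (2 ^ X * 2 ^ X) := Nat.mul_le_mul h0 (Nat.mul_le_mul h0 h4)
    _ = 2 ^ (3 * X) := by ring
    _ ≤ _ := Nat.pow_le_pow_right (by norm_num) (by omega)

theorem Small.entry_lt (h : Small s₀ X) (j : ℕ) {v : ℕ} (hv : v < rowLength s₀) :
    entry s₀ j v < 2 ^ (6 * X) := by
  have h2 : s₀.var 2 + 1 ≤ 2 ^ X := h.bounded.var 2
  calc entry s₀ j v ≤ v * (s₀.var 2 + 1) := minCost_le _ _ _ _ _
    _ < rowLength s₀ * 2 ^ X := Nat.mul_lt_mul_of_lt_of_le hv h2 (by positivity)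
    _ ≤ 2 ^ (4 * X) * 2 ^ X := Nat.mul_le_mul_right _ h.rowLength_le
    _ = 2 ^ (5 * X) := by ring
    _ ≤ _ := Nat.pow_le_pow_right (by norm_num) (by omega)

theorem Small.index_lt (h : Small s₀ X) {k : ℕ} (hk : k ≤ s₀.var 0 * rowLength s₀) :
    k < 2 ^ (6 * X) := by
  have h0 : s₀.var 0 < 2 ^ X := h.bounded.var 0
  have hr : 0 < rowLength s₀ := Nat.succ_pos _
  calc k ≤ s₀.var 0 * rowLength s₀ := hk
    _ < 2 ^ X * rowLength s₀ := Nat.mul_lt_mul_of_pos_right h0 hr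
    _ ≤ 2 ^ X * 2 ^ (4 * X) := Nat.mul_le_mul_left _ h.rowLength_le
    _ = 2 ^ (5 * X) := by ring
    _ ≤ _ := Nat.pow_le_pow_right (by norm_num) (by omega)

theorem Small.rowLength_lt (h : Small s₀ X) : rowLength s₀ < 2 ^ (6 * X) :=
  h.rowLength_le.trans_lt (Nat.pow_lt_pow_right (by norm_num) (by have := h.pos; omega))

theorem Small.var_lt (h : Small s₀ X) (x : ℕ) : s₀.var x < 2 ^ (6 * X) :=
  (h.bounded.var x).trans_le (Nat.pow_le_pow_right (by norm_num) (by omega))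

theorem Small.bounded_mul (h : Small s₀ X) : Bounded (6 * X) s₀ where
  pos := by have := h.pos; omega
  var := h.var_lt
  arr a i := (h.bounded.arr a i).trans_le (Nat.pow_le_pow_right (by norm_num) (by omega))

end spec

/-! ### Correctness -/

/-- `s` has the same input as `s₀`, and all its values have at most `b` bits. -/
structure Keeps (b : ℕ) (s₀ s : State) : Prop where
  bounded : Bounded b s
  var (x : ℕ) (hx : x < 5) : s.var x = s₀.var x
  arr (a : ℕ) (ha : a < 2) : s.arr a = s₀.arr a

/-! ### Loop invariants -/

section invariants
variable {b : ℕ} {s₀ s : State}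

theorem Keeps.setVar (h : Keeps b s₀ s) {x k : ℕ} (hx : 5 ≤ x) (hk : k < 2 ^ b) :
    Keeps b s₀ (s.setVar x k) where
  bounded := h.bounded.setVar x hk
  var y hy := by rw [State.setVar_var, if_neg (by omega), h.var y hy]
  arr := h.arr

theorem Keeps.setArr (h : Keeps b s₀ s) {a i k : ℕ} (ha : 2 ≤ a) (hk : k < 2 ^ b) :
    Keeps b s₀ (s.setArr a i k) where
  bounded := h.bounded.setArr a i hk
  var := h.var
  arr a' ha' := by rw [State.setArr_arr, if_neg (by omega), h.arr a' ha']

/-- The profits of the items below `j` have been computed. -/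
structure Profits (b : ℕ) (s₀ : State) (j : ℕ) (s : State) : Prop extends Keeps b s₀ s where
  max : s.var 8 = maxProfit s₀ j
  profit (i : ℕ) (hi : i < j) : s.arr 3 i = profit s₀ i

theorem Profits.setVar {j : ℕ} (h : Profits b s₀ j s) {x k : ℕ} (hx : 5 ≤ x) (hk : k < 2 ^ b)
    (hx' : x ≠ 8) : Profits b s₀ j (s.setVar x k) where
  toKeeps := h.toKeeps.setVar hx hk
  max := by rw [State.setVar_var, if_neg hx'.symm, h.max]
  profit := h.profit

theorem Profits.setArr {j : ℕ} (h : Profits b s₀ j s) {a i k : ℕ} (ha : 2 ≤ a) (hk : k < 2 ^ b)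
    (ha' : a ≠ 3) : Profits b s₀ j (s.setArr a i k) where
  toKeeps := h.toKeeps.setArr ha hk
  max := h.max
  profit i hi := by rw [State.setArr_arr, if_neg ha'.symm, h.profit i hi]

theorem Profits.scaledExpr_eval (h : Profits b s₀ (s₀.var 0) s) (hj : s.var 5 < s₀.var 0) :
    scaledExpr.eval s = scaled s₀ (s.var 5) := by
  simp [scaledExpr, scaled, h.max, h.profit _ hj, h.var]

/-- The first `k` cells of the table have been computed. -/
structure Table (b : ℕ) (s₀ : State) (k : ℕ) (s : State) : Prop
    extends Profits b s₀ (s₀.var 0) s where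
  length : s.var 9 = rowLength s₀
  table (i : ℕ) (hi : i < k) : s.arr 4 i = entry s₀ (i / rowLength s₀) (i % rowLength s₀)

theorem Table.setVar {j : ℕ} (h : Table b s₀ j s) {x k : ℕ} (hx : 5 ≤ x) (hk : k < 2 ^ b)
    (hx' : x ≠ 8) (hx'' : x ≠ 9) : Table b s₀ j (s.setVar x k) where
  toProfits := h.toProfits.setVar hx hk hx'
  length := by rw [State.setVar_var, if_neg hx''.symm, h.length]
  table := h.table

theorem Table.setArr {j : ℕ} (h : Table b s₀ j s) {a i k : ℕ} (ha : 2 ≤ a) (hk : k < 2 ^ b)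
    (ha' : a ≠ 3) (ha'' : a ≠ 4) : Table b s₀ j (s.setArr a i k) where
  toProfits := h.toProfits.setArr ha hk ha'
  length := h.length
  table i hi := by rw [State.setArr_arr, if_neg ha''.symm, h.table i hi]

theorem Table.extend {k t : ℕ} (h : Table b s₀ k s) (ht : t < 2 ^ b)
    (he : t = entry s₀ (k / rowLength s₀) (k % rowLength s₀)) :
    Table b s₀ (k + 1) (s.setArr 4 k t) where
  toProfits := h.toProfits.setArr (by norm_num) ht (by norm_num)
  length := h.length
  table i hi := by
    rw [State.setArr_arr, if_pos rfl, Function.update_apply]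
    split
    · next hik => rw [hik, he]
    · exact h.table i (by omega)

theorem Table.cell {k j v : ℕ} (h : Table b s₀ k s) (hv : v < rowLength s₀)
    (hk : j * rowLength s₀ + v < k) : s.arr 4 (j * rowLength s₀ + v) = entry s₀ j v := by
  rw [h.table _ hk, mul_comm, Nat.mul_add_div (by omega), Nat.mul_add_mod, Nat.div_eq_of_lt hv,
    Nat.mod_eq_of_lt hv, add_zero]

end invariants

/-- A bound for the weights of the expressions of the program. -/
def maxWeight : ℕ := 10 ^ 15

/-! ### The four phases of the program -/

section correctness
variable {X : ℕ} {s₀ s : State}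

theorem runs_profitProgram (h : Small s₀ X) (hs : Keeps (6 * X) s₀ s) :
    Runs (maxWeight * (6 * X) ^ 2) profitProgram s
      (1 + (s₀.var 0 * ((1 + (s₀.var 1 * 3 + 2 + (1 + 2))) + 2) + 2))
      (Profits (6 * X) s₀ (s₀.var 0)) := by
  have hpow : 0 < 2 ^ (6 * X) := by positivity
  refine Runs.seq (Q := Profits (6 * X) s₀ 0) (Runs.assign 8 hs.bounded (by decide) ?_) ?_
  · exact ⟨hs.setVar (by norm_num) hpow, by simp [maxProfit], by simp⟩
  intro s hs
  refine (Runs.forLoop (fun j s => j ≤ s₀.var 0 ∧ Profits (6 * X) s₀ j s ∧ s.var 5 = j) 5 (s₀.var 0)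
    (by decide) (by decide) hs.bounded ?_ ?_ ?_).mono le_rfl fun s hs => hs.2.1
  · exact ⟨by omega, hs.setVar (by norm_num) hpow (by norm_num), by simp⟩
  · rintro j s ⟨-, hs, hj⟩
    exact ⟨hs.bounded, hj, hs.var 0 (by norm_num)⟩
  rintro j s hjm ⟨-, hs, hj⟩
  refine Runs.seq (Q := fun s => Profits (6 * X) s₀ j s ∧ s.var 5 = j ∧ s.var 7 = 0)
    (Runs.assign 7 hs.bounded (by decide) ?_) ?_
  · exact ⟨hs.setVar (by norm_num) hpow (by norm_num), by simpa using hj, by simp⟩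
  rintro s ⟨hs, hj, h7⟩
  refine Runs.seq (Q := fun s => Profits (6 * X) s₀ j s ∧ s.var 5 = j ∧
    s.var 7 = ∑ i ∈ Finset.range (s₀.var 1), s₀.arr 1 (i * s₀.var 0 + j)) ?_ ?_
  · refine (Runs.forLoop (fun k s => Profits (6 * X) s₀ j s ∧ s.var 5 = j ∧ s.var 6 = k ∧
      s.var 7 = ∑ i ∈ Finset.range k, s₀.arr 1 (i * s₀.var 0 + j)) 6 (s₀.var 1)
      (by decide) (by decide) hs.bounded ?_ ?_ ?_ (k := 1)).mono le_rfl
      fun s hs => ⟨hs.1, hs.2.1, hs.2.2.2⟩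
    · exact ⟨hs.setVar (by norm_num) hpow (by norm_num), by simpa using hj, by simp,
        by simpa using h7⟩
    · rintro k s ⟨hs, -, h6, -⟩
      exact ⟨hs.bounded, h6, hs.var 1 (by norm_num)⟩
    rintro k s hk ⟨hs, hj, h6, h7⟩
    have hv : (Expr.var 7 + .cell 1 (.var 6 * .var 0 + .var 5)).eval s =
        ∑ i ∈ Finset.range (k + 1), s₀.arr 1 (i * s₀.var 0 + j) := by
      simp [Finset.sum_range_succ, hj, h6, h7, hs.var 0 (by norm_num), hs.arr 1 (by norm_num)]
    have hlt : (Expr.var 7 + .cell 1 (.var 6 * .var 0 + .var 5)).eval s < 2 ^ (6 * X) := by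
      rw [hv]
      exact ((h.sum_le _ _).trans hk).trans_lt (h.var_lt 1)
    have hs' := hs.setVar (x := 7) (by norm_num) hlt (by norm_num)
    refine Runs.assign 7 hs.bounded (by decide) ⟨hs'.bounded, by simpa using h6, ?_, ?_, ?_, ?_⟩
    · exact hs'.setVar (by norm_num) (lt_of_le_of_lt hk (h.var_lt 1)) (by norm_num)
    · simpa using hj
    · simp
    · simpa using hv
  rintro s ⟨hs, hj, h7⟩
  have hv : (Expr.var 7 * .cell 0 (.var 5)).eval s = profit s₀ j := by
    simp [profit, hj, h7, hs.arr 0 (by norm_num)]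
  -- Between the store and the update of the maximum, the profits are known below `j + 1` but the
  -- maximum only below `j`, so `Profits` fits neither index.
  refine Runs.seq (Q := fun s => Keeps (6 * X) s₀ s ∧ s.var 5 = j ∧ s.var 8 = maxProfit s₀ j ∧
    ∀ i < j + 1, s.arr 3 i = profit s₀ i) (Runs.store 3 hs.bounded (by decide) ?_) ?_
  · refine ⟨hs.toKeeps.setArr (by norm_num) (hv ▸ h.profit_lt j), hj, hs.max, fun i hi => ?_⟩
    rw [hv]
    simp only [State.setArr_arr, if_true, Expr.eval_var, hj, Function.update_apply]
    split
    · next hij => rw [hij]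
    · exact hs.profit i (by omega)
  rintro s ⟨hs, hj, h8, h3⟩
  -- A product of truncated differences encodes the conjunction of two comparisons.
  have hv : ((Expr.var 2 + 1 - .cell 0 (.var 5)) * (.cell 3 (.var 5) - .var 8)).eval s ≠ 0 ↔
      s₀.arr 0 j ≤ s₀.var 2 ∧ maxProfit s₀ j < profit s₀ j := by
    simp only [Expr.eval_mul, Expr.eval_sub, Expr.eval_add, Expr.eval_var, Expr.eval_one,
      Expr.eval_cell, hj, h8, h3 j (by omega), hs.var 2 (by norm_num), hs.arr 0 (by norm_num),
      mul_ne_zero_iff]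
    omega
  have hjlt : j + 1 < 2 ^ (6 * X) := lt_of_le_of_lt hjm (h.var_lt 0)
  have hprofit : (Expr.cell 3 (.var 5)).eval s = profit s₀ j := by simp [hj, h3 j]
  refine Runs.branch (k := 1) hs.bounded (by decide) (fun he => ?_) (fun he => ?_)
  · have hs' := hs.setVar (x := 8) (by norm_num) (hprofit ▸ h.profit_lt j)
    refine Runs.assign 8 hs.bounded (by decide) ⟨hs'.bounded, by simpa using hj, by omega, ?_, ?_⟩
    · refine ⟨hs'.setVar (by norm_num) hjlt, ?_, h3⟩
      rw [maxProfit, if_pos (hv.1 he), hprofit]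
      simp
    · simp
  · refine Runs.skip hs.bounded (by decide) ⟨hs.bounded, hj, by omega, ?_, by simp⟩
    refine ⟨hs.setVar (by norm_num) hjlt, ?_, h3⟩
    rw [maxProfit, if_neg (fun hc => hv.2 hc he)]
    simpa using h8

/-- The table is filled in linear order. With `k = j * rowLength s₀ + v`, the cell `k + rowLength
s₀` holds row `j + 1`, column `v`, and depends only on row `j`, which is already complete. -/
theorem runs_tableProgram (h : Small s₀ X) (hs : Profits (6 * X) s₀ (s₀.var 0) s) :
    Runs (maxWeight * (6 * X) ^ 2) tableProgram s
      (1 + (rowLength s₀ * 3 + 2 + (s₀.var 0 * rowLength s₀ * ((1 + (1 + 1)) + 2) + 2)))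
      (Table (6 * X) s₀ (s₀.var 0 * rowLength s₀ + rowLength s₀)) := by
  have hpow : 0 < 2 ^ (6 * X) := by positivity
  have hL : 0 < rowLength s₀ := Nat.succ_pos _
  refine Runs.seq (Q := Table (6 * X) s₀ 0) (Runs.assign 9 hs.bounded (by decide) ?_) ?_
  · have hv : (Expr.var 0 * (.var 0 * .var 4 / .var 3 + 1) + 1).eval s = rowLength s₀ := by
      simp [rowLength, hs.var]
    exact ⟨hs.setVar (by norm_num) (hv ▸ h.rowLength_lt) (by norm_num), by rw [hv]; simp, by simp⟩
  intro s hs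
  refine Runs.seq (Q := Table (6 * X) s₀ (rowLength s₀)) ?_ ?_
  · refine (Runs.forLoop (fun k s => Table (6 * X) s₀ k s ∧ s.var 10 = k) 10 (rowLength s₀)
      (by decide) (by decide) hs.bounded ?_ ?_ ?_ (k := 1)).mono le_rfl fun s hs => hs.1
    · exact ⟨hs.setVar (by norm_num) hpow (by norm_num) (by norm_num), by simp⟩
    · rintro k s ⟨hs, h10⟩
      exact ⟨hs.bounded, h10, hs.length⟩
    rintro k s hk ⟨hs, h10⟩
    have hv : (Expr.var 10 * (.var 2 + 1)).eval s = entry s₀ 0 k := by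
      simp [entry, minCost, h10, hs.var 2 (by norm_num)]
    have hk' : (Expr.var 10).eval s = k := h10
    have hs' := hs.extend (hv ▸ h.entry_lt 0 hk)
      (by rw [hv, Nat.div_eq_of_lt hk, Nat.mod_eq_of_lt hk])
    refine Runs.store 4 hs.bounded (by decide) ?_
    rw [hk']
    exact ⟨hs'.bounded, h10, hs'.setVar (by norm_num) (lt_of_le_of_lt hk h.rowLength_lt)
      (by norm_num) (by norm_num), by simp⟩
  intro s hs
  refine (Runs.forLoop (fun k s => Table (6 * X) s₀ (k + rowLength s₀) s ∧ s.var 10 = k) 10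
    (s₀.var 0 * rowLength s₀) (by decide) (by decide) hs.bounded ?_ ?_ ?_).mono
    le_rfl fun s hs => hs.1
  · exact ⟨by simpa using hs.setVar (by norm_num) hpow (by norm_num) (by norm_num), by simp⟩
  · rintro k s ⟨hs, h10⟩
    exact ⟨hs.bounded, h10, by simp [hs.length, hs.var]⟩
  rintro k s hk ⟨hs, h10⟩
  have hj : k / rowLength s₀ < s₀.var 0 := (Nat.div_lt_iff_lt_mul hL).2 hk
  have hmod : k % rowLength s₀ < rowLength s₀ := Nat.mod_lt _ hL
  have hdm : k / rowLength s₀ * rowLength s₀ + k % rowLength s₀ = k := Nat.div_add_mod' _ _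
  set j := k / rowLength s₀ with hjdef
  set v := k % rowLength s₀ with hvdef
  refine Runs.seq (Q := fun s => Table (6 * X) s₀ (k + rowLength s₀) s ∧ s.var 10 = k ∧ s.var 5 = j)
    (Runs.assign 5 hs.bounded (by decide) ?_) ?_
  · have he : (Expr.var 10 / .var 9).eval s = j := by simp [h10, hs.length, hjdef]
    rw [he]
    exact ⟨hs.setVar (by norm_num) (hj.trans (h.var_lt 0)) (by norm_num) (by norm_num),
      by simpa using h10, by simp⟩
  rintro s ⟨hs, h10, h5⟩
  refine Runs.seq (k₁ := 1) (k₂ := 1) (Q := fun s =>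
    Table (6 * X) s₀ (k + rowLength s₀) s ∧ s.var 10 = k ∧ s.var 5 = j ∧ s.var 6 = j * rowLength s₀ + (v - scaled s₀ j)) (Runs.assign 6 hs.bounded (by decide) ?_) ?_
  · have he : (Expr.var 5 * .var 9 + ((.var 10 - .var 5 * .var 9) - scaledExpr)).eval s =
        j * rowLength s₀ + (v - scaled s₀ j) := by
      simp only [Expr.eval_add, Expr.eval_sub, Expr.eval_mul, Expr.eval_var,
        hs.scaledExpr_eval (by omega), h5, h10, hs.length]
      congr 2
      omega
    rw [he]
    exact ⟨hs.setVar (by norm_num) (h.index_lt (by omega)) (by norm_num) (by norm_num),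
      by simpa using h10, by simpa using h5, by simp⟩
  rintro s ⟨hs, h10, h5, h6⟩
  have hcell : s.arr 4 k = entry s₀ j v := by
    have := hs.cell hmod (j := j) (by omega)
    rwa [hdm] at this
  have hcell' : s.arr 4 (j * rowLength s₀ + (v - scaled s₀ j)) = entry s₀ j (v - scaled s₀ j) :=
    hs.cell (by omega) (by omega)
  -- With truncated subtraction, `x - (x - y)` is `min x y`.
  have hv : (Expr.cell 4 (.var 10) -
      (.cell 4 (.var 10) - (.cell 0 (.var 5) + .cell 4 (.var 6)))).eval s = entry s₀ (j + 1) v := by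
    simp only [Expr.eval_add, Expr.eval_sub, Expr.eval_cell, Expr.eval_var, h5, h6, h10, hcell,
      hcell', hs.arr 0 (by norm_num)]
    simp only [entry, minCost]
    omega
  have hi : (Expr.var 10 + .var 9).eval s = k + rowLength s₀ := by simp [h10, hs.length]
  have hs' := hs.extend (hv ▸ h.entry_lt (j + 1) hmod)
    (by rw [hv, Nat.add_div_right _ hL, Nat.add_mod_right])
  refine Runs.store 4 hs.bounded (by decide) ?_
  rw [hi]
  refine ⟨hs'.bounded, h10, ?_, by simp⟩
  rw [add_right_comm]
  exact hs'.setVar (by norm_num) (h.index_lt hk) (by norm_num) (by norm_num)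

/-- The largest value `v` that is attained within the limit has been found. -/
structure Found (b : ℕ) (s₀ : State) (v : ℕ) (s : State) : Prop
    extends Table b s₀ (s₀.var 0 * rowLength s₀ + rowLength s₀) s where
  lt : v < rowLength s₀
  best : s.var 6 = v
  entry_lt (u : ℕ) (hvu : v < u) (hu : u < rowLength s₀) : s₀.var 2 < entry s₀ (s₀.var 0) u

/-- The search descends from the last column and stops at column `0` at the latest, where the cost
is `0`. The current column itself bounds the remaining iterations. -/
theorem runs_searchProgram (h : Small s₀ X)
    (hs : Table (6 * X) s₀ (s₀.var 0 * rowLength s₀ + rowLength s₀) s) :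
    Runs (maxWeight * (6 * X) ^ 2) searchProgram s (1 + ((rowLength s₀ - 1) * (1 + 1) + 1))
      (fun s => ∃ v, Found (6 * X) s₀ v s ∧ entry s₀ (s₀.var 0) v ≤ s₀.var 2) := by
  have hL : 0 < rowLength s₀ := Nat.succ_pos _
  have hcond (v : ℕ) (s : State) (hs : Found (6 * X) s₀ v s) :
      (Expr.cell 4 (.var 0 * .var 9 + .var 6) - .var 2).eval s =
        entry s₀ (s₀.var 0) v - s₀.var 2 := by
    have := hs.cell (j := s₀.var 0) hs.lt (by have := hs.lt; omega)
    simp [hs.var, hs.length, hs.best, this]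
  refine Runs.seq (Q := Found (6 * X) s₀ (rowLength s₀ - 1))
    (Runs.assign 6 hs.bounded (by decide) ?_) ?_
  · have he : (Expr.var 9 - 1).eval s = rowLength s₀ - 1 := by simp [hs.length]
    rw [he]
    refine ⟨hs.setVar (by norm_num) ?_ (by norm_num) (by norm_num), by omega, by simp,
      fun u _ _ => by omega⟩
    exact lt_of_le_of_lt (Nat.sub_le _ _) h.rowLength_lt
  intro s hs
  refine (Runs.loop (Found (6 * X) s₀) (by decide) (fun v s hs => hs.bounded) ?_ hs).mono le_rfl ?_
  · intro v s hs he
    rw [hcond v s hs] at he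
    obtain ⟨u, rfl⟩ : ∃ u, v = u + 1 := by
      refine Nat.exists_eq_succ_of_ne_zero ?_
      rintro rfl
      exact he (by simp [entry, minCost_zero])
    have hv : (Expr.var 6 - 1).eval s = u := by simp [hs.best]
    have hu := hs.lt
    refine ⟨u, rfl, Runs.assign 6 hs.bounded (by decide) ?_⟩
    rw [hv]
    refine ⟨hs.setVar (by norm_num) (lt_trans (by omega) h.rowLength_lt) (by norm_num)
      (by norm_num), by omega, by simp, fun w hw hwL => ?_⟩
    by_cases hwu : w = u + 1
    · rw [hwu]
      omega
    · exact hs.entry_lt w (by omega) hwL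
  · rintro s ⟨v, hs, he⟩
    rw [hcond v s hs] at he
    exact ⟨v, hs, by omega⟩

theorem runs_outputProgram (h : Small s₀ X) {v : ℕ}
    (hs : Table (6 * X) s₀ (s₀.var 0 * rowLength s₀ + rowLength s₀) s)
    (hv : v < rowLength s₀) (h6 : s.var 6 = v) :
    Runs (maxWeight * (6 * X) ^ 2) outputProgram s
      (1 + (s₀.var 0 * ((1 + (1 + 2)) + 1) + 1))
      (fun s => ∀ i < s₀.var 0, s.arr 2 i = if i ∈ picked s₀ (s₀.var 0) v then 1 else 0) := by
  have hL : 0 < rowLength s₀ := Nat.succ_pos _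
  -- With `j` rows left and current column `u`, the part of the solution below `j` is `picked s₀ j
  -- u`; the output cells from `j` on are final. Comparing rows `j` and `j + 1` in column `u`
  -- repeats the test in `pick`.
  let I : ℕ → State → Prop := fun j s =>
    Table (6 * X) s₀ (s₀.var 0 * rowLength s₀ + rowLength s₀) s ∧ j ≤ s₀.var 0 ∧ s.var 5 = j ∧
      s.var 6 < rowLength s₀ ∧
      (∀ i < j, i ∈ picked s₀ (s₀.var 0) v ↔ i ∈ picked s₀ j (s.var 6)) ∧
      ∀ i < s₀.var 0, j ≤ i → s.arr 2 i = if i ∈ picked s₀ (s₀.var 0) v then 1 else 0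
  refine Runs.seq (Q := I (s₀.var 0)) (Runs.assign 5 hs.bounded (by decide) ?_) ?_
  · have he : (Expr.var 0).eval s = s₀.var 0 := hs.var 0 (by norm_num)
    rw [he]
    exact ⟨hs.setVar (by norm_num) (h.var_lt 0) (by norm_num) (by norm_num), le_rfl, by simp,
      by simpa [h6] using hv, by simp [h6], fun i hi hi' => by omega⟩
  intro s hs
  refine (Runs.loop I (by decide) (fun v s hs => hs.1.bounded) ?_ hs).mono le_rfl ?_
  · rintro j s ⟨hs, hj, h5, h6, hpick, hout⟩ he
    obtain ⟨j, rfl⟩ : ∃ i, j = i + 1 := Nat.exists_eq_succ_of_ne_zero fun hj0 => he (by simp [h5, hj0])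
    refine ⟨j, rfl, ?_⟩
    generalize hu : s.var 6 = u at h6 hpick
    refine Runs.seq (Q := fun s =>
      Table (6 * X) s₀ (s₀.var 0 * rowLength s₀ + rowLength s₀) s ∧ s.var 5 = j ∧ s.var 6 = u ∧
      ∀ i < s₀.var 0, j + 1 ≤ i → s.arr 2 i = if i ∈ picked s₀ (s₀.var 0) v then 1 else 0)
      (Runs.assign 5 hs.bounded (by decide) ?_) ?_
    · have he : (Expr.var 5 - 1).eval s = j := by simp [h5]
      rw [he]
      exact ⟨hs.setVar (by norm_num) (lt_trans hj (h.var_lt 0)) (by norm_num) (by norm_num),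
        by simp, by simpa using hu, hout⟩
    clear hs h5 hu hout he
    rintro s ⟨hs, h5, h6', hout⟩
    have hjL : (j + 1) * rowLength s₀ ≤ s₀.var 0 * rowLength s₀ := Nat.mul_le_mul_right _ hj
    have hjL' : j * rowLength s₀ ≤ s₀.var 0 * rowLength s₀ := Nat.mul_le_mul_right _ (by omega)
    have hcell := hs.cell (j := j) h6 (by omega)
    have hcell' := hs.cell (j := j + 1) h6 (by omega)
    have hcond : (Expr.cell 4 (.var 5 * .var 9 + .var 6) -
        .cell 4 ((.var 5 + 1) * .var 9 + .var 6)).eval s = entry s₀ j u - entry s₀ (j + 1) u := by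
      simp [h5, h6', hs.length, hcell, hcell']
    have hone : 1 < 2 ^ (6 * X) := Nat.one_lt_two_pow (by have := h.pos; omega)
    have hmem : j ∉ picked s₀ j (u - scaled s₀ j) := fun hmem => by
      simpa using pick_subset _ _ _ _ _ hmem
    have hmem' : j ∉ picked s₀ j u := fun hmem => by
      simpa using pick_subset _ _ _ _ _ hmem
    refine Runs.branch (k := 2) hs.bounded (by decide) (fun he => ?_) (fun he => ?_)
    · have hp : picked s₀ (j + 1) u = insert j (picked s₀ j (u - scaled s₀ j)) := by
        rw [hcond] at he
        exact if_pos (by change entry s₀ (j + 1) u < entry s₀ j u; omega)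
      have hs' := hs.setArr (a := 2) (i := j) (by norm_num) hone (by norm_num) (by norm_num)
      refine Runs.seq (k₁ := 1) (k₂ := 1) (Q := fun s' => s' = s.setArr 2 j 1)
        (Runs.store 2 hs.bounded (by decide) (by simp [h5])) ?_
      rintro _ rfl
      have hv : (Expr.var 6 - scaledExpr).eval (s.setArr 2 j 1) = u - scaled s₀ j := by
        simp only [Expr.eval_sub, Expr.eval_var,
          hs'.scaledExpr_eval (by rw [State.setArr_var]; omega), State.setArr_var, h5, h6']
      refine Runs.assign 6 hs'.bounded (by decide) ?_
      rw [hv]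
      refine ⟨hs'.setVar (by norm_num) (lt_trans (by omega) h.rowLength_lt) (by norm_num)
        (by norm_num), by omega, by simpa using h5, by simp; omega, fun i hi => ?_,
        fun i hi hij => ?_⟩
      · rw [hpick i (by omega), hp]
        simp [hi.ne]
      · by_cases hij' : i = j
        · subst hij'
          have : i ∈ picked s₀ (s₀.var 0) v := by rw [hpick i (by omega), hp]; simp
          simp [this]
        · simp [hij', hout i hi (by omega)]
    · have hp : picked s₀ (j + 1) u = picked s₀ j u := by
        rw [hcond] at he
        exact if_neg (by change ¬ entry s₀ (j + 1) u < entry s₀ j u; omega)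
      have hs' := hs.setArr (a := 2) (i := j) (k := 0) (by norm_num) (by omega) (by norm_num)
        (by norm_num)
      have he : (Expr.var 5).eval s = j := h5
      have he' : (0 : Expr).eval s = 0 := rfl
      refine Runs.mono (k₁ := 1) (Q := I j) (Runs.store 2 hs.bounded (by decide) ?_) (by norm_num)
        fun _ h => h
      rw [he, he']
      refine ⟨hs', by omega, h5, by simpa [h6'] using h6, fun i hi => ?_, fun i hi hij => ?_⟩
      · rw [hpick i (by omega), hp, State.setArr_var, h6']
      · by_cases hij' : i = j
        · subst hij'
          have : i ∉ picked s₀ (s₀.var 0) v := by rwa [hpick i (by omega), hp]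
          simp [this]
        · simp [hij', hout i hi (by omega)]
  · rintro s ⟨j, ⟨-, -, h5, -, -, hout⟩, he⟩
    have : j = 0 := by rwa [Expr.eval_var, h5] at he
    exact fun i hi => hout i hi (by omega)

theorem runs_budgetProgram (h : Small s₀ X) :
    Runs (maxWeight * (6 * X) ^ 2) budgetProgram s₀
      (10 * (s₀.var 0 * s₀.var 1 + 4 * s₀.var 0 + s₀.var 0 * rowLength s₀ + rowLength s₀ + 2))
      (fun s => ∃ v < rowLength s₀, entry s₀ (s₀.var 0) v ≤ s₀.var 2 ∧
        (∀ u, v < u → u < rowLength s₀ → s₀.var 2 < entry s₀ (s₀.var 0) u) ∧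
        ∀ i < s₀.var 0, s.arr 2 i = if i ∈ picked s₀ (s₀.var 0) v then 1 else 0) := by
  refine ((runs_profitProgram h ⟨h.bounded_mul, fun _ _ => rfl, fun _ _ => rfl⟩).seq fun s hs =>
    (runs_tableProgram h hs).seq fun s hs => (runs_searchProgram h hs).seq ?_).mono
    (k₁ := _ + (_ + (_ + (1 + (s₀.var 0 * ((1 + (1 + 2)) + 1) + 1))))) ?_ fun s hs => hs
  · rintro s ⟨v, hs, hv⟩
    exact (runs_outputProgram h hs.toTable hs.lt hs.best).mono le_rfl
      fun s' hs' => ⟨v, hs.lt, hv, hs.entry_lt, hs'⟩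
  · have : rowLength s₀ - 1 ≤ rowLength s₀ := Nat.sub_le _ _
    nlinarith

end correctness

/-! ### Budgets of the scenario -/

section scenario
variable {E : Scenario} {ε : ℚ}

/-- The items of a scenario as natural numbers. -/
def Scenario.items (B : Finset (Fin E.m)) : Finset ℕ := B.map Fin.valEmbedding

theorem Scenario.items_subset (B : Finset (Fin E.m)) : Scenario.items B ⊆ Finset.range E.m := by
  intro i hi
  obtain ⟨j, -, rfl⟩ := Finset.mem_map.1 hi
  simp

theorem Scenario.exists_items_eq {S : Finset ℕ} (hS : S ⊆ Finset.range E.m) :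
    ∃ B : Finset (Fin E.m), Scenario.items B = S ∧ ∀ j : Fin E.m, j ∈ B ↔ (j : ℕ) ∈ S := by
  refine ⟨Finset.univ.filter fun j => (j : ℕ) ∈ S, ?_, by simp⟩
  ext i
  simp only [items, Finset.mem_map, Finset.mem_filter, Finset.mem_univ, true_and]
  constructor
  · rintro ⟨j, hj, rfl⟩
    exact hj
  · intro hi
    exact ⟨⟨i, Finset.mem_range.1 (hS hi)⟩, hi, rfl⟩

theorem initialState_cost (j : Fin E.m) : (initialState E ε).arr 0 j = E.cost j := by
  simp [initialState]

theorem initialState_approval (i : Fin E.n) (j : Fin E.m) :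
    (initialState E ε).arr 1 (i * E.m + j) = if j ∈ E.approval i then 1 else 0 := by
  have hdiv : ((i : ℕ) * E.m + j) / E.m = i := by
    rw [mul_comm, Nat.mul_add_div (by have := j.2; omega), Nat.div_eq_of_lt j.2, add_zero]
  have hmod : ((i : ℕ) * E.m + j) % E.m = j := by
    rw [mul_comm, Nat.mul_add_mod, Nat.mod_eq_of_lt j.2]
  simp [initialState, hdiv, hmod]

theorem sum_items_cost (B : Finset (Fin E.m)) :
    ∑ i ∈ Scenario.items B, (initialState E ε).arr 0 i = ∑ j ∈ B, E.cost j := by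
  simp [Scenario.items, initialState_cost]

theorem profit_eq (j : Fin E.m) :
    profit (initialState E ε) j = ∑ v, if j ∈ E.approval v then E.cost j else 0 := by
  have h : ∑ i ∈ Finset.range E.n, (initialState E ε).arr 1 (i * E.m + j) =
      ∑ v : Fin E.n, if j ∈ E.approval v then 1 else 0 := by
    rw [Finset.sum_range]
    exact Finset.sum_congr rfl fun i _ => initialState_approval i j
  change (∑ i ∈ Finset.range E.n, (initialState E ε).arr 1 (i * E.m + j)) * _ = _
  rw [h, initialState_cost, Finset.sum_mul]
  exact Finset.sum_congr rfl fun v _ => by split <;> simp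

/-- Exchanging the sums over voters and items turns total satisfaction into a knapsack objective. -/
theorem sum_items_profit (B : Finset (Fin E.m)) :
    ∑ i ∈ Scenario.items B, profit (initialState E ε) i =
      E.totalSatisfaction (costSatisfaction E.cost) B := by
  simp only [Scenario.items, Finset.sum_map, Fin.valEmbedding_apply, profit_eq,
    Scenario.totalSatisfaction, costSatisfaction]
  rw [Finset.sum_comm]
  refine Finset.sum_congr rfl fun v _ => ?_
  rw [← Finset.sum_filter, Finset.inter_comm, Finset.filter_mem_eq_inter]

/-- The length of the input, plus `1 / ε` rounded up. -/
def inputMeasure (E : Scenario) (ε : ℚ) : ℕ := E.size + ratSize ε + ⌈1 / ε⌉₊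

theorem cost_size_le (j : Fin E.m) : (E.cost j).size ≤ inputMeasure E ε := by
  have := Finset.single_le_sum (f := fun j => (E.cost j).size + 1) (fun _ _ => Nat.zero_le _)
    (Finset.mem_univ j)
  simp only [inputMeasure, Scenario.size]
  omega

/-- The `+ 1` that `Scenario.size` charges for each cost counts the items. -/
theorem items_le : E.m ≤ inputMeasure E ε := by
  have : ∑ _j : Fin E.m, 1 ≤ ∑ j, ((E.cost j).size + 1) :=
    Finset.sum_le_sum fun _ _ => by omega
  simp only [Finset.sum_const, Finset.card_univ, Fintype.card_fin, smul_eq_mul, mul_one] at this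
  simp only [inputMeasure, Scenario.size]
  omega

theorem small_initialState : Small (initialState E ε) (inputMeasure E ε) where
  pos := by
    have : 0 < ε.den.size := Nat.size_pos.2 ε.den_pos
    simp only [inputMeasure, ratSize]
    omega
  bounded := by
    have hpos : 0 < ε.den.size := Nat.size_pos.2 ε.den_pos
    refine ⟨by simp only [inputMeasure, ratSize]; omega, fun x => ?_, fun a i => ?_⟩
    · rw [← Nat.size_le]
      match x with
      | 0 | 1 | 2 | 3 | 4 =>
        simp only [initialState, inputMeasure, ratSize, Scenario.size]
        omega
      | _ + 5 => simp [initialState]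
    · rw [← Nat.size_le]
      match a with
      | 0 =>
        simp only [initialState]
        split
        · exact cost_size_le _
        · simp
      | 1 =>
        have : 1 ≤ inputMeasure E ε := by simp only [inputMeasure, ratSize]; omega
        simp only [initialState]
        split_ifs <;> simp [this]
      | _ + 2 => simp [initialState]
  arr_one k := by
    simp only [initialState]
    split_ifs <;> simp

/-- The left side is `k / ε` rounded down; this brings `1 / ε` into the bound on the row length. -/
theorem div_num_le (hε : 0 < ε) (k : ℕ) : k * ε.den / ε.num.toNat ≤ k * ⌈1 / ε⌉₊ := by
  have hnum : 0 < ε.num := Rat.num_pos.2 hε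
  have hcast : ((ε.num.toNat : ℕ) : ℚ) = (ε.num : ℚ) := by
    exact_mod_cast congrArg (Int.cast : ℤ → ℚ) (Int.toNat_of_nonneg hnum.le)
  have hden : ε.den ≤ ε.num.toNat * ⌈1 / ε⌉₊ := by
    have h1 : (1 : ℚ) / ε ≤ ⌈1 / ε⌉₊ := Nat.le_ceil _
    have h2 : (ε.num : ℚ) = ε * ε.den := (Rat.mul_den_eq_num ε).symm
    have h3 : (ε.den : ℚ) ≤ ε.num.toNat * ⌈1 / ε⌉₊ := by
      rw [hcast, h2]
      calc (ε.den : ℚ) = ε * ε.den * (1 / ε) := by field_simp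
        _ ≤ _ := mul_le_mul_of_nonneg_left h1 (by positivity)
    exact_mod_cast h3
  refine Nat.div_le_of_le_mul ?_
  calc k * ε.den ≤ k * (ε.num.toNat * ⌈1 / ε⌉₊) := Nat.mul_le_mul_left _ hden
    _ = _ := by ring

theorem rowLength_le (hε : 0 < ε) :
    rowLength (initialState E ε) ≤ (inputMeasure E ε + 1) ^ 3 := by
  have hm : E.m ≤ inputMeasure E ε := items_le
  have hc : ⌈1 / ε⌉₊ ≤ inputMeasure E ε := Nat.le_add_left _ _
  have hd := div_num_le hε E.m
  change E.m * (E.m * ε.den / ε.num.toNat + 1) + 1 ≤ _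
  generalize inputMeasure E ε = X at *
  have h1 : E.m * ⌈1 / ε⌉₊ ≤ X * X := Nat.mul_le_mul hm hc
  have h2 : E.m * (E.m * ε.den / ε.num.toNat + 1) ≤ X * (X * X + 1) :=
    Nat.mul_le_mul hm (by omega)
  nlinarith [Nat.zero_le X, Nat.zero_le (X * X)]

/-- Items of an affordable set have small scaled profits, so that the set has a column. -/
theorem sum_scaled_lt {W : Finset ℕ} (hW : W ⊆ Finset.range E.m) (hε : 0 < ε)
    (hl : ∑ i ∈ W, (initialState E ε).arr 0 i ≤ E.limit) :
    ∑ i ∈ W, scaled (initialState E ε) i < rowLength (initialState E ε) := by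
  have hnum : 0 < ε.num.toNat := by
    have := Rat.num_pos.2 hε
    omega
  have hq (i : ℕ) (hi : i ∈ W) :
      scaled (initialState E ε) i ≤ E.m * ε.den / ε.num.toNat + 1 := by
    have hp : profit (initialState E ε) i ≤ maxProfit (initialState E ε) E.m :=
      profit_le_maxProfit (Finset.mem_range.1 (hW hi))
        ((Finset.single_le_sum (fun _ _ => Nat.zero_le _) hi).trans hl)
    change profit (initialState E ε) i * (E.m * ε.den) /
      (ε.num.toNat * maxProfit (initialState E ε) E.m) ≤ _
    generalize maxProfit (initialState E ε) E.m = M at *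
    -- The inner `+ 1` in `rowLength` is slack: already `m / ε`, rounded down, bounds each scaled
    -- profit.
    refine le_trans ?_ (Nat.le_succ _)
    rcases Nat.eq_zero_or_pos M with rfl | hM
    · simp
    · calc _ ≤ M * (E.m * ε.den) / (M * ε.num.toNat) := by
            rw [mul_comm ε.num.toNat]
            exact Nat.div_le_div_right (Nat.mul_le_mul_right _ hp)
        _ = _ := Nat.mul_div_mul_left _ _ hM
  refine Nat.lt_succ_of_le ((Finset.sum_le_card_nsmul W _ _ hq).trans ?_)
  have hcard : W.card ≤ E.m := by simpa using Finset.card_le_card hW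
  exact Nat.mul_le_mul_right _ hcard

/-- A budget whose scaled profit is at least that of an optimal budget is nearly optimal. -/
theorem nearly_optimal (hε : 0 < ε) {B W : Finset (Fin E.m)}
    (hW : W ∈ E.maxRule (costSatisfaction E.cost))
    (h : ∑ i ∈ Scenario.items W, scaled (initialState E ε) i ≤
      ∑ i ∈ Scenario.items B, scaled (initialState E ε) i) :
    (1 - ε) * (E.totalSatisfaction (costSatisfaction E.cost) W : ℚ) ≤
      (E.totalSatisfaction (costSatisfaction E.cost) B : ℚ) := by
  have hmax (j : Fin E.m) (hj : E.cost j ≤ E.limit) : profit (initialState E ε) j ≤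
      E.totalSatisfaction (costSatisfaction E.cost) W := by
    have := hW.2 {j} (by simpa [Scenario.Feasible] using hj)
    rw [← sum_items_profit (ε := ε) {j}] at this
    simpa [Scenario.items] using this
  have hM : maxProfit (initialState E ε) E.m ≤
      E.totalSatisfaction (costSatisfaction E.cost) W := by
    obtain h0 | ⟨i, hi, hil, hp⟩ := exists_profit_eq_maxProfit (initialState E ε) E.m
    · omega
    · rw [← hp]
      exact hmax ⟨i, hi⟩ (by rwa [← initialState_cost (ε := ε)])
  -- If the maximum is `0`, the scaling divides by zero and carries no information, but then every
  -- feasible budget has satisfaction `0`.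
  rcases Nat.eq_zero_or_pos (maxProfit (initialState E ε) E.m) with h0 | hpos
  · have hzero : E.totalSatisfaction (costSatisfaction E.cost) W = 0 := by
      rw [← sum_items_profit (ε := ε)]
      refine Finset.sum_eq_zero fun i hi => ?_
      have hil : (initialState E ε).arr 0 i ≤ E.limit :=
        (Finset.single_le_sum (fun _ _ => Nat.zero_le _) hi).trans
          ((sum_items_cost W).trans_le hW.1)
      have := profit_le_maxProfit (s₀ := initialState E ε)
        (Finset.mem_range.1 (Scenario.items_subset W hi)) hil
      omega
    rw [hzero]
    simp
  have hnum : 0 < ε.num := Rat.num_pos.2 hε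
  have hm : 0 < E.m := Nat.pos_of_ne_zero fun h0 => by
    rw [h0] at hpos
    exact absurd hpos (by simp [maxProfit])
  -- Here `N / D = ε M / m`, so at most `m` items lose at most `ε M` together.
  have key := sum_le_of_scaled (p := profit (initialState E ε)) (q := scaled (initialState E ε))
    (D := E.m * ε.den) (N := ε.num.toNat * maxProfit (initialState E ε) E.m)
    (Nat.mul_pos (by omega) hpos) (fun _ => rfl) h
  rw [sum_items_profit, sum_items_profit] at key
  have hcard : (Scenario.items W).card ≤ E.m := by
    simpa using Finset.card_le_card (Scenario.items_subset W)
  generalize E.totalSatisfaction (costSatisfaction E.cost) W = w at *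
  generalize E.totalSatisfaction (costSatisfaction E.cost) B = u at *
  have key' : w * (E.m * ε.den) ≤ u * (E.m * ε.den) + E.m * (ε.num.toNat * w) :=
    key.trans (Nat.add_le_add_left (Nat.mul_le_mul hcard (Nat.mul_le_mul_left _ hM)) _)
  have key'' : w * ε.den ≤ u * ε.den + ε.num.toNat * w :=
    Nat.le_of_mul_le_mul_left (c := E.m) (by linarith) hm
  have hcast : ((ε.num.toNat : ℕ) : ℚ) = ε * ε.den := by
    rw [Rat.mul_den_eq_num]
    exact_mod_cast congrArg (Int.cast : ℤ → ℚ) (Int.toNat_of_nonneg hnum.le)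
  have hQ : (w : ℚ) * ε.den ≤ u * ε.den + ε.num.toNat * w := by exact_mod_cast key''
  rw [hcast] at hQ
  have hden : (0 : ℚ) < ε.den := by exact_mod_cast ε.den_pos
  refine le_of_mul_le_mul_right ?_ hden
  linarith

end scenario

/-- The number of voters enters only through `n * m`, which is part of the input size. Alone it is
written in binary, and without items it could be exponential in the size. -/
theorem steps_le {m n r X : ℕ} (hm : m ≤ X) (hmn : n * m ≤ X) (hr : r ≤ (X + 1) ^ 3) :
    10 * (m * n + 4 * m + m * r + r + 2) ≤ 80 * (X + 1) ^ 4 := by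
  have h1 : (m + 1) * r ≤ (X + 1) * (X + 1) ^ 3 := Nat.mul_le_mul (by omega) hr
  have h2 : X + 1 ≤ (X + 1) ^ 4 := Nat.le_self_pow (by norm_num) _
  nlinarith

end Budgeting

open Budgeting in
theorem mainTheorem12 :
    ∃ P : Budgeting.Program,
      Budgeting.IsFPTAS (fun E => Budgeting.costSatisfaction E.cost) P := by
  -- The first factor bounds the number of steps, the second the cost of one step.
  refine ⟨budgetProgram, 80 * (Polynomial.X + 1) ^ 4 *
    (Polynomial.C maxWeight * (6 * Polynomial.X) ^ 2), fun E ε hε => ?_⟩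
  obtain ⟨t, s, hrun, ht, v, hv, hvl, hbest, hout⟩ :=
    runs_budgetProgram (small_initialState (E := E) (ε := ε))
  have hspec := pick_spec _ (scaled (initialState E ε)) _ _ _ hvl
  obtain ⟨B, hB, hmem⟩ := Scenario.exists_items_eq (E := E)
    (S := picked (initialState E ε) E.m v) (pick_subset _ _ _ _ _)
  change ∑ i ∈ picked (initialState E ε) E.m v, _ ≤ E.limit ∧ _ ∧
    v ≤ ∑ i ∈ picked (initialState E ε) E.m v, _ at hspec
  rw [← hB] at hspec
  refine ⟨t, s, B, hrun, ht.trans ?_, fun j => ?_, ?_, fun W hW => ?_⟩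
  · have hmn : E.n * E.m ≤ inputMeasure E ε := by
      simp only [inputMeasure, Scenario.size]
      omega
    have := steps_le (items_le (E := E) (ε := ε)) hmn (rowLength_le hε)
    have := Nat.mul_le_mul_right (maxWeight * (6 * inputMeasure E ε) ^ 2) this
    exact this.trans_eq (by simp [inputMeasure])
  · rw [hout j j.2]
    exact if_congr (hmem j).symm rfl rfl
  · exact (sum_items_cost B).symm.trans_le hspec.1
  · refine nearly_optimal hε hW (le_trans ?_ hspec.2.2)
    -- If `W` had scaled value above `v`, its column would exist and would have been rejected for a
    -- least cost over the limit; yet `W` attains that value within the limit.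
    by_contra! hlt
    have hWl : ∑ i ∈ Scenario.items W, (initialState E ε).arr 0 i ≤ E.limit :=
      (sum_items_cost W).trans_le hW.1
    have h1 := hbest _ hlt (sum_scaled_lt (Scenario.items_subset W) hε hWl)
    have h2 := minCost_le_sum ((initialState E ε).arr 0) (scaled (initialState E ε)) E.limit E.m _
      (Scenario.items W) (Scenario.items_subset W) le_rfl
    exact absurd (h2.trans hWl) (not_le.2 h1)
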